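/- Let $B$ be a standard Brownian motion, let $a,b,x\in\mathbb R$ with $b\neq 0$, let $u$ be a known right-continuous waveform with left limits, and let $x_t$ be the continuous process with $dx_t = a x_t\,dt + b\,dB_t + u_t\,dt$, $x_0=x$. Let $\mathcal F^x_t=\sigma(x_s: s\le t)$, let $T\ge 0$ be a horizon and $N\ge 1$ a number of samples. For stopping times $\tau_1\le\dots\le\tau_m\le h$ of $(\mathcal F^x_t)$ let $\Sigma_t=\{(\tau_i,x_{\tau_i}):\tau_i\le t\}$ be the data available to the estimator at time $t$ and $\hat x_t=\mathbb E[x_t\mid\Sigma_t]$ the MMSE estimate, and let $J^*(h,m)$ be the infimum of the distortion $\mathbb E\int_0^h (x_s-\hat x_s)^2\,ds$ over all such $(\tau_1,\dots,\tau_m)$. For an $(\mathcal F^x_t)$-stopping time $\tau$ with values in $[0,T]$ and a Borel measurable deterministic waveform $\xi=\{\xi_t\}_{t\in[0,T]}$ put $$ H(\tau,\xi)=\mathbb E\Big[\int_0^\tau (x_s-\xi_s)^2\,ds+J^*(T-\tau,N-1)\Big]\in[0,\infty],\qquad G(\xi)=\inf_\tau H(\tau,\xi).$$ Let $\xi^*$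 be a waveform that minimises $G$, and let $\tau^*=T^*(\xi^*)$ be an optimal stopping time for $\xi^*$, i.e. $H(\tau^*,\xi^*)=G(\xi^*)$. Then: 1. $(\tau^*,\xi^*)$ minimises $H$ jointly: $H(\tau^*,\xi^*)\le H(\tau,\xi)$ for all stopping times $\tau\le T$ and all waveforms $\xi$. 2. $\xi^*$ is the MMSE estimate under the stopping rule $\tau^*$: for Lebesgue-almost every $t\in[0,T]$, $x_t$ is integrable; if $P(\tau^*>t)>0$ then $\xi^*_t=\mathbb E[x_t\mid\tau^*>t]$; and almost surely on the event $\{\tau^*>t\}$, $\xi^*_t=\mathbb E[x_t\mid\Sigma_t]$, where $\Sigma_t$ is the data generated by the single sampling time $\tau^*$. -/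

import Mathlib

open MeasureTheory ProbabilityTheory Set Filter Topology
open scoped NNReal ENNReal

noncomputable section

namespace AdaptiveSampling

/-- Lebesgue measure on the time axis `[0, ∞)`. -/
def leb : Measure ℝ≥0 := (volume.restrict (Ici (0 : ℝ))).map Real.toNNReal

/-- Right-continuous with left limits (RCLL) on `[0, ∞)`. -/
def IsRCLL (u : ℝ≥0 → ℝ) : Prop :=
  ∀ t, ContinuousWithinAt u (Ici t) t ∧ ∃ l : ℝ, Tendsto u (𝓝[<] t) (𝓝 l)

/-- A scalar linear diffusion `dx_t = a x_t dt + b dB_t + u_t dt`, `x_0 = x₀`, with `b ≠ 0`, known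
coefficients, known initial value and known RCLL control waveform `u`, driven by a standard
Brownian motion `B`. As the noise is additive, the equation is read pathwise in integral form. -/
structure LinearDiffusion {Ω : Type*} [MeasurableSpace Ω] (P : Measure Ω) where
  /-- drift coefficient -/
  a : ℝ
  /-- noise coefficient -/
  b : ℝ
  /-- initial value -/
  x₀ : ℝ
  /-- control waveform -/
  u : ℝ≥0 → ℝ
  /-- driving Brownian motion -/
  B : ℝ≥0 → Ω → ℝ
  /-- state process -/
  x : ℝ≥0 → Ω → ℝ
  b_ne_zero : b ≠ 0
  rcll_u : IsRCLL u
  brownian : IsBrownianReal B P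
  measurable_x : ∀ t, Measurable (x t)
  continuous_x : ∀ ω, Continuous fun t => x t ω
  state_eq : ∀ᵐ ω ∂P, ∀ t : ℝ≥0,
    x t ω = x₀ + (∫ s in (0 : ℝ)..t, (a * x s.toNNReal ω + u s.toNNReal)) + b * B t ω

namespace LinearDiffusion

variable {Ω : Type*} [MeasurableSpace Ω] {P : Measure Ω}

/-- The filtration `F^x_t = σ(x_s, s ≤ t)` generated by the state process. -/
def filtration (S : LinearDiffusion P) : Filtration ℝ≥0 (inferInstance : MeasurableSpace Ω) :=
  Filtration.natural S.x fun t => (S.measurable_x t).stronglyMeasurable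

/-- `τ` is a stopping time of the state process with values in `[0, h]`. -/
def IsSamplingTime (S : LinearDiffusion P) (h : ℝ≥0) (τ : Ω → ℝ≥0) : Prop :=
  IsStoppingTime S.filtration (fun ω => (τ ω : WithTop ℝ≥0)) ∧ ∀ ω, τ ω ≤ h

/-- An increasing sequence of `m` sampling times in `[0, h]`. (A sampling time may equal `h`, so
this also covers the use of fewer than `m` samples.) -/
def IsSamplingPolicy (S : LinearDiffusion P) (h : ℝ≥0) {m : ℕ} (τ : Fin m → Ω → ℝ≥0) : Prop :=
  (∀ i, S.IsSamplingTime h (τ i)) ∧ ∀ ω, Monotone fun i => τ i ω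

open Classical in
/-- The packet of the sampling time `τ` as seen at time `t`: `(1, τ, x_τ)` if `τ ≤ t`, and the
dummy value `(0, 0, 0)` if it has not arrived yet. -/
def packet (S : LinearDiffusion P) (τ : Ω → ℝ≥0) (t : ℝ≥0) (ω : Ω) : ℝ × ℝ × ℝ :=
  if τ ω ≤ t then (1, (τ ω : ℝ), S.x (τ ω) ω) else (0, 0, 0)

/-- The σ-algebra generated by the data `Σ_t = {(τ_i, x_{τ_i}) : τ_i ≤ t}` available to the
estimator at time `t` (the initial value is a known constant and adds nothing). -/
@[reducible] def dataSigma (S : LinearDiffusion P) {m : ℕ} (τ : Fin m → Ω → ℝ≥0) (t : ℝ≥0) :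
    MeasurableSpace Ω :=
  ⨆ i, MeasurableSpace.comap (S.packet (τ i) t) inferInstance

/-- The MMSE estimate `x̂_t = E[x_t | Σ_t]`. -/
def mmse (S : LinearDiffusion P) {m : ℕ} (τ : Fin m → Ω → ℝ≥0) (t : ℝ≥0) : Ω → ℝ :=
  P[S.x t | S.dataSigma τ t]

/-- The aggregate squared error distortion `E ∫₀ʰ (x_s - x̂_s)² ds` of a sampling policy. The
expectation is taken inside the time integral (Tonelli), so that the value does not depend on the
versions of the conditional expectations `x̂_s`. -/
def distortion (S : LinearDiffusion P) (h : ℝ≥0) {m : ℕ} (τ : Fin m → Ω → ℝ≥0) : ℝ≥0∞ :=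
  ∫⁻ s in Iio h, ∫⁻ ω, ENNReal.ofReal ((S.x s ω - S.mmse τ s ω) ^ 2) ∂P ∂leb

/-- `J*(h, m)`: the minimum distortion over a horizon of length `h` with `m` samples. -/
def Jstar (S : LinearDiffusion P) (h : ℝ≥0) (m : ℕ) : ℝ≥0∞ :=
  ⨅ (τ : Fin m → Ω → ℝ≥0) (_ : S.IsSamplingPolicy h τ), S.distortion h τ

/-- `H(τ, ξ) = E[∫₀^τ (x_s - ξ_s)² ds + J*(T - τ, N - 1)]`. -/
def H (S : LinearDiffusion P) (T : ℝ≥0) (N : ℕ) (τ : Ω → ℝ≥0) (ξ : ℝ≥0 → ℝ) : ℝ≥0∞ :=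
  ∫⁻ ω, ((∫⁻ s in Iio (τ ω), ENNReal.ofReal ((S.x s ω - ξ s) ^ 2) ∂leb)
    + S.Jstar (T - τ ω) (N - 1)) ∂P

/-- `G(ξ)`: the optimal value of the stopping problem with the waveform `ξ` fixed. -/
def G (S : LinearDiffusion P) (T : ℝ≥0) (N : ℕ) (ξ : ℝ≥0 → ℝ) : ℝ≥0∞ :=
  ⨅ (τ : Ω → ℝ≥0) (_ : S.IsSamplingTime T τ), S.H T N τ ξ

/-- `τ` is an optimal stopping time `T*(ξ)` for the waveform `ξ`: it attains `G(ξ)`. -/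
def IsOptimalStopping (S : LinearDiffusion P) (T : ℝ≥0) (N : ℕ) (ξ : ℝ≥0 → ℝ)
    (τ : Ω → ℝ≥0) : Prop :=
  S.IsSamplingTime T τ ∧ S.H T N τ ξ = S.G T N ξ

end LinearDiffusion

end AdaptiveSampling

end

/-! Joint optimality is a property of iterated infima: `H(τ, ξ) = G(ξ) ≤ G(η) ≤ H(σ, η)`. In
particular `ξ` minimises `H(τ, ·)` with `τ` frozen. By Tonelli the running cost is an integral over
`s` of the squared error on the survival event `{s < τ}`, so the minimisation decouples over time.
The bias-variance identity on that event shows that replacing `ξ_s` by the survival mean saves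
exactly `P(s < τ)` times the squared gap between them; optimality makes the total saving vanish
(`ae_eq_survivalMean_of_H_le`). Since the data at time `t` cannot split `{t < τ}`, the MMSE estimate
there is the elementary conditional mean (`mmse_eq_survivalMean`).

Cancelling costs requires a finite optimal value, which rests on `lintegral_sq_ne_top`: the state
equation gives a pathwise integral inequality, truncation makes the moments finite, and a Grönwall
bound uniform in the truncation level allows passing to the limit. -/

namespace AdaptiveSampling

/-! ### Lebesgue measure on the half line -/

instance : SFinite leb := by unfold leb; infer_instance

lemma leb_Ico_le (s t : ℝ≥0) : leb (Ico s t) ≤ ((t - s : ℝ≥0) : ℝ≥0∞) := by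
  rw [leb, Measure.map_apply measurable_real_toNNReal measurableSet_Ico,
    Measure.restrict_apply (measurable_real_toNNReal measurableSet_Ico)]
  have hsub : Real.toNNReal ⁻¹' Ico s t ∩ Ici 0 ⊆ Ico (s : ℝ) t := by
    rintro y ⟨⟨h1, h2⟩, h0⟩
    have hy : ((Real.toNNReal y : ℝ≥0) : ℝ) = y := Real.coe_toNNReal y h0
    exact ⟨by rw [← hy]; exact_mod_cast h1, by rw [← hy]; exact_mod_cast h2⟩
  refine (measure_mono hsub).trans ?_
  rw [Real.volume_Ico]
  exact ENNReal.coe_le_coe.2 NNReal.sub_def.ge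

/-- Set integrals over `[0, t)` with respect to `leb` as integrals on the real line. -/
lemma setLIntegral_leb_Iio {f : ℝ≥0 → ℝ≥0∞} (hf : Measurable f) (t : ℝ≥0) :
    ∫⁻ s in Iio t, f s ∂leb = ∫⁻ s in Ioc (0 : ℝ) t, f s.toNNReal := by
  rw [leb, setLIntegral_map measurableSet_Iio hf measurable_real_toNNReal,
    Measure.restrict_restrict (measurable_real_toNNReal measurableSet_Iio)]
  have e : Real.toNNReal ⁻¹' Iio t ∩ Ici 0 = Ico (0 : ℝ) t := by
    ext y
    constructor
    · rintro ⟨h1, h0⟩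
      exact ⟨h0, by rw [← Real.coe_toNNReal y h0]; exact_mod_cast h1⟩
    · rintro ⟨h0, h1⟩
      refine ⟨?_, h0⟩
      rw [← Real.coe_toNNReal y h0] at h1
      exact_mod_cast h1
  rw [e, restrict_Ico_eq_restrict_Ioc]

/-! ### An integral Grönwall inequality with a uniform bound -/

/-- Time is advanced in steps so short that the new integral reappears on the right with factor at
most `1/2` and can be absorbed. The point of the form is that `D` is chosen before `F`: finiteness
is assumed, but the bound does not depend on its size. -/
theorem exists_lintegral_le_of_le_const_add_mul_lintegral (C K T : ℝ≥0) :
    ∃ D : ℝ≥0, ∀ F : ℝ≥0 → ℝ≥0∞,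
      (∀ t < T, F t ≤ C + K * ∫⁻ s in Iio t, F s ∂leb) → ∫⁻ s in Iio T, F s ∂leb ≠ ∞ →
      ∫⁻ s in Iio T, F s ∂leb ≤ D := by
  set δ : ℝ≥0 := (2 * (K + 1))⁻¹ with hδ
  have hδ0 : 0 < δ := by positivity
  have hδK : δ * K ≤ 2⁻¹ := by
    have h1 : δ * (2 * (K + 1)) = 1 := inv_mul_cancel₀ (by positivity)
    rw [← NNReal.coe_le_coe]
    have h2 : (δ : ℝ) * (2 * (K + 1)) = 1 := by exact_mod_cast h1
    push_cast
    nlinarith [hδ0.le, NNReal.coe_pos.2 hδ0]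
  have key : ∀ m : ℕ, ∃ D : ℝ≥0, ∀ F : ℝ≥0 → ℝ≥0∞,
      (∀ t < T, F t ≤ C + K * ∫⁻ s in Iio t, F s ∂leb) → ∫⁻ s in Iio T, F s ∂leb ≠ ∞ →
      ∫⁻ s in Iio (min (m * δ) T), F s ∂leb ≤ D := by
    intro m
    induction m with
    | zero => exact ⟨0, fun F _ _ => by simp⟩
    | succ m ih =>
      obtain ⟨D, hD⟩ := ih
      refine ⟨2 * (D + δ * C), fun F hF hfin => ?_⟩
      set t₀ := min (m * δ) T
      set t₁ := min ((m + 1 : ℕ) * δ) T with ht₁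
      have h01 : t₁ - t₀ ≤ δ := by
        rw [tsub_le_iff_left]
        have : ((m + 1 : ℕ) * δ) = m * δ + δ := by push_cast; ring
        rw [ht₁, this]
        rcases le_total (m * δ) T with h | h
        · rw [show t₀ = m * δ from min_eq_left h]; exact min_le_left _ _
        · rw [show t₀ = T from min_eq_right h]; exact (min_le_right _ _).trans le_self_add
      -- Absorption subtracts this integral from both sides, hence the a priori finiteness.
      have hφ : ∫⁻ s in Iio t₁, F s ∂leb ≠ ∞ :=
        ((lintegral_mono_set (Iio_subset_Iio (min_le_right _ _))).trans_lt hfin.lt_top).ne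
      have hstep : ∫⁻ s in Iio t₁, F s ∂leb
          ≤ D + δ * (C + K * ∫⁻ s in Iio t₁, F s ∂leb) := by
        calc ∫⁻ s in Iio t₁, F s ∂leb
            ≤ ∫⁻ s in Iio t₀ ∪ Ico t₀ t₁, F s ∂leb := by
              refine lintegral_mono_set fun s hs => ?_
              rcases lt_or_ge s t₀ with h | h
              · exact Or.inl h
              · exact Or.inr ⟨h, hs⟩
          _ ≤ ∫⁻ s in Iio t₀, F s ∂leb + ∫⁻ s in Ico t₀ t₁, F s ∂leb :=
              lintegral_union_le _ _ _
          _ ≤ D + ∫⁻ _ in Ico t₀ t₁, (C + K * ∫⁻ s in Iio t₁, F s ∂leb) ∂leb := by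
              refine add_le_add (hD F hF hfin) (setLIntegral_mono measurable_const fun s hs => ?_)
              refine (hF s (hs.2.trans_le (min_le_right _ _))).trans ?_
              gcongr
              exact hs.2.le
          _ ≤ D + δ * (C + K * ∫⁻ s in Iio t₁, F s ∂leb) := by
              rw [setLIntegral_const, mul_comm]
              gcongr
              exact (leb_Ico_le _ _).trans (by exact_mod_cast h01)
      lift ∫⁻ s in Iio t₁, F s ∂leb to ℝ≥0 using hφ with p
      norm_cast at hstep ⊢
      rw [← NNReal.coe_le_coe] at hstep hδK ⊢
      push_cast at hstep hδK ⊢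
      nlinarith [p.coe_nonneg]
  obtain ⟨m, hm⟩ := exists_nat_gt (T / δ)
  obtain ⟨D, hD⟩ := key m
  refine ⟨D, fun F hF hfin => ?_⟩
  have h := hD F hF hfin
  rwa [min_eq_right] at h
  exact ((div_lt_iff₀ hδ0).1 hm).le

/-- An RCLL function is bounded on compact time intervals. -/
lemma IsRCLL.exists_bound {u : ℝ≥0 → ℝ} (hu : IsRCLL u) (T : ℝ≥0) :
    ∃ M : ℝ, 0 ≤ M ∧ ∀ t ≤ T, |u t| ≤ M := by
  have key : ∃ M : ℝ, ∀ t ∈ Iic T, |u t| ≤ M := by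
    have hc : IsCompact (Iic T) := by
      have e : Iic T = Icc 0 T := by ext; simp
      rw [e]; exact isCompact_Icc
    refine hc.induction_on (p := fun s => ∃ M : ℝ, ∀ t ∈ s, |u t| ≤ M) ⟨0, by simp⟩ ?_ ?_ ?_
    · rintro s t hst ⟨M, hM⟩
      exact ⟨M, fun r hr => hM r (hst hr)⟩
    · rintro s t ⟨M, hM⟩ ⟨M', hM'⟩
      refine ⟨max M M', fun r hr => ?_⟩
      rcases hr with hr | hr
      · exact (hM r hr).trans (le_max_left _ _)
      · exact (hM' r hr).trans (le_max_right _ _)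
    · intro t _
      obtain ⟨hr, l, hl⟩ := hu t
      have h1 : ∀ᶠ s in 𝓝[≥] t, |u s| ≤ |u t| + 1 :=
        (hr.abs.eventually (gt_mem_nhds (lt_add_one _))).mono fun s hs => hs.le
      have h2 : ∀ᶠ s in 𝓝[<] t, |u s| ≤ |l| + 1 :=
        (hl.abs.eventually (gt_mem_nhds (lt_add_one _))).mono fun s hs => hs.le
      have h3 : ∀ᶠ s in 𝓝 t, |u s| ≤ max (|u t| + 1) (|l| + 1) := by
        rw [← nhdsLT_sup_nhdsGE, eventually_sup]
        exact ⟨h2.mono fun s hs => hs.trans (le_max_right _ _),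
          h1.mono fun s hs => hs.trans (le_max_left _ _)⟩
      exact ⟨_, mem_nhdsWithin_of_mem_nhds h3, _, fun s hs => hs⟩
  obtain ⟨M, hM⟩ := key
  exact ⟨max M 0, le_max_right _ _, fun t ht => (hM t ht).trans (le_max_left _ _)⟩

/-- Cauchy-Schwarz for the integral of a continuous function against `1`. -/
lemma sq_integral_abs_le {f : ℝ → ℝ} (hf : Continuous f) {t : ℝ} (ht : 0 ≤ t) :
    (∫ s in (0 : ℝ)..t, |f s|) ^ 2 ≤ t * ∫ s in (0 : ℝ)..t, f s ^ 2 := by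
  rcases ht.eq_or_lt with rfl | ht
  · simp
  set I := ∫ s in (0 : ℝ)..t, |f s| with hI
  -- Tangent-line bound for the square at the mean value `I / t` of `|f|`.
  have h : ∫ s in (0 : ℝ)..t, (2 * (I / t) * |f s| - (I / t) ^ 2) ≤
      ∫ s in (0 : ℝ)..t, f s ^ 2 := by
    refine intervalIntegral.integral_mono_on ht.le
      (Continuous.intervalIntegrable (by fun_prop) _ _)
      (Continuous.intervalIntegrable (by fun_prop) _ _) fun s _ => ?_
    nlinarith [sq_nonneg (|f s| - I / t), sq_abs (f s)]
  rw [intervalIntegral.integral_sub (Continuous.intervalIntegrable (by fun_prop) _ _)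
    (Continuous.intervalIntegrable (by fun_prop) _ _), intervalIntegral.integral_const_mul, ← hI,
    intervalIntegral.integral_const, smul_eq_mul, sub_zero] at h
  have e : I ^ 2 = t * (2 * (I / t) * I - t * (I / t) ^ 2) := by
    field_simp; ring
  rw [e]
  exact mul_le_mul_of_nonneg_left h ht.le

/-! ### Second moments of the state -/

namespace LinearDiffusion

variable {Ω : Type*} [MeasurableSpace Ω] {P : Measure Ω}

lemma measurable_uncurry_x (S : LinearDiffusion P) : Measurable (Function.uncurry S.x) :=
  measurable_uncurry_of_continuous_of_measurable S.continuous_x S.measurable_x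

lemma setLIntegral_sq_x (S : LinearDiffusion P) (t : ℝ≥0) (ω : Ω) :
    ∫⁻ s in Iio t, ENNReal.ofReal (S.x s ω ^ 2) ∂leb =
      ENNReal.ofReal (∫ s in (0 : ℝ)..t, S.x s.toNNReal ω ^ 2) := by
  have hx := S.continuous_x ω
  have hc : Continuous fun s : ℝ => S.x s.toNNReal ω ^ 2 :=
    (hx.comp continuous_real_toNNReal).pow 2
  rw [setLIntegral_leb_Iio (f := fun s => ENNReal.ofReal (S.x s ω ^ 2))
      (hx.pow 2).measurable.ennreal_ofReal,
    intervalIntegral.integral_of_le t.coe_nonneg,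
    ofReal_integral_eq_lintegral_ofReal
      ((intervalIntegrable_iff_integrableOn_Ioc_of_le t.coe_nonneg).1
        (hc.intervalIntegrable _ _)) (Eventually.of_forall fun s => sq_nonneg _)]

/-- The pathwise integral inequality for the squared state. -/
lemma ae_sq_le (S : LinearDiffusion P) (T : ℝ≥0) :
    ∃ C K : ℝ≥0, ∀ᵐ ω ∂P, ∀ t < T, ENNReal.ofReal (S.x t ω ^ 2) ≤
      C + ENNReal.ofReal (3 * S.b ^ 2 * S.B t ω ^ 2)
        + K * ∫⁻ s in Iio t, ENNReal.ofReal (S.x s ω ^ 2) ∂leb := by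
  obtain ⟨M, hM0, hM⟩ := S.rcll_u.exists_bound T
  -- The factor 3 comes from `(p + q + r)² ≤ 3(p² + q² + r²)`, for the bounded part, the linear
  -- drift and the noise; Cauchy-Schwarz on the drift contributes `T`.
  refine ⟨Real.toNNReal (3 * (|S.x₀| + M * T) ^ 2), Real.toNNReal (3 * (S.a ^ 2 * T)), ?_⟩
  filter_upwards [S.state_eq] with ω hω t htT
  have htT' : (t : ℝ) ≤ T := by exact_mod_cast htT.le
  have hc : Continuous fun s : ℝ => S.x s.toNNReal ω :=
    (S.continuous_x ω).comp continuous_real_toNNReal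
  set I := ∫ s in (0 : ℝ)..t, |S.x s.toNNReal ω| with hI
  set Q := ∫ s in (0 : ℝ)..t, S.x s.toNNReal ω ^ 2 with hQ
  have hI0 : 0 ≤ I := intervalIntegral.integral_nonneg t.coe_nonneg fun s _ => abs_nonneg _
  have hQ0 : 0 ≤ Q := intervalIntegral.integral_nonneg t.coe_nonneg fun s _ => sq_nonneg _
  have hdrift : |∫ s in (0 : ℝ)..t, (S.a * S.x s.toNNReal ω + S.u s.toNNReal)|
      ≤ |S.a| * I + M * T := by
    calc |∫ s in (0 : ℝ)..t, (S.a * S.x s.toNNReal ω + S.u s.toNNReal)|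
        ≤ ∫ s in (0 : ℝ)..t, (|S.a| * |S.x s.toNNReal ω| + M) := by
          rw [← Real.norm_eq_abs]
          refine intervalIntegral.norm_integral_le_of_norm_le t.coe_nonneg
            (Eventually.of_forall fun s hs => ?_)
            (Continuous.intervalIntegrable (by fun_prop) _ _)
          rw [Real.norm_eq_abs]
          refine (abs_add_le _ _).trans (add_le_add (abs_mul _ _).le (hM _ ?_))
          exact (Real.toNNReal_le_iff_le_coe.2 hs.2).trans htT.le
      _ = |S.a| * I + M * t := by
          rw [intervalIntegral.integral_add (Continuous.intervalIntegrable (by fun_prop) _ _)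
            (Continuous.intervalIntegrable (by fun_prop) _ _),
            intervalIntegral.integral_const_mul, intervalIntegral.integral_const, smul_eq_mul,
            sub_zero, mul_comm M]
      _ ≤ |S.a| * I + M * T := by gcongr
  have hIQ : I ^ 2 ≤ T * Q :=
    (sq_integral_abs_le hc t.coe_nonneg).trans (mul_le_mul_of_nonneg_right htT' hQ0)
  have hx : |S.x t ω| ≤ (|S.x₀| + M * T) + |S.a| * I + |S.b * S.B t ω| := by
    rw [hω t]
    refine (abs_add_le _ _).trans (add_le_add ((abs_add_le _ _).trans ?_) le_rfl)
    linarith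
  have hsq : S.x t ω ^ 2 ≤ 3 * (|S.x₀| + M * T) ^ 2 + 3 * S.b ^ 2 * S.B t ω ^ 2
      + 3 * (S.a ^ 2 * T) * Q := by
    have h1 : S.x t ω ^ 2 ≤ ((|S.x₀| + M * T) + |S.a| * I + |S.b * S.B t ω|) ^ 2 := by
      rw [← sq_abs]; gcongr
    have h2 : (|S.a| * I) ^ 2 ≤ S.a ^ 2 * T * Q := by
      rw [mul_pow, sq_abs, mul_assoc]
      exact mul_le_mul_of_nonneg_left hIQ (sq_nonneg _)
    have h3 : |S.b * S.B t ω| ^ 2 = S.b ^ 2 * S.B t ω ^ 2 := by rw [sq_abs, mul_pow]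
    nlinarith [sq_nonneg ((|S.x₀| + M * T) - |S.a| * I),
      sq_nonneg ((|S.x₀| + M * T) - |S.b * S.B t ω|), sq_nonneg (|S.a| * I - |S.b * S.B t ω|)]
  rw [S.setLIntegral_sq_x t ω]
  refine (ENNReal.ofReal_le_ofReal hsq).trans ?_
  rw [ENNReal.ofReal_add (by positivity) (by positivity),
    ENNReal.ofReal_add (by positivity) (by positivity),
    ENNReal.ofReal_mul (p := 3 * (S.a ^ 2 * T)) (by positivity)]
  exact le_rfl

lemma lintegral_sq_brownian (S : LinearDiffusion P) (t : ℝ≥0) :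
    ∫⁻ ω, ENNReal.ofReal (S.B t ω ^ 2) ∂P = t := by
  have hlaw := S.brownian.hasLaw_eval t
  have hL : MemLp (fun y : ℝ => y) 2 (gaussianReal 0 t) := memLp_id_gaussianReal 2
  have hv := variance_id_gaussianReal (μ := 0) (v := t)
  rw [variance_eq_integral aemeasurable_id] at hv
  simp only [id, integral_id_gaussianReal, sub_zero] at hv
  have e : ∫⁻ ω, ENNReal.ofReal (S.B t ω ^ 2) ∂P
      = ∫⁻ y, ENNReal.ofReal (y ^ 2) ∂gaussianReal 0 t :=
    hlaw.lintegral_comp (f := fun y : ℝ => ENNReal.ofReal (y ^ 2)) (by fun_prop)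
  rw [e, ← ofReal_integral_eq_lintegral_ofReal hL.integrable_sq
    (Eventually.of_forall fun y => sq_nonneg y)]
  rw [hv, ENNReal.ofReal_coe_nnreal]

/-- The state has finite aggregate second moment over every bounded horizon. -/
theorem lintegral_sq_ne_top [IsProbabilityMeasure P] (S : LinearDiffusion P) (T : ℝ≥0) :
    ∫⁻ ω, ∫⁻ s in Iio T, ENNReal.ofReal (S.x s ω ^ 2) ∂leb ∂P ≠ ∞ := by
  obtain ⟨C, K, hCK⟩ := S.ae_sq_le T
  set c : ℝ≥0 := C + Real.toNNReal (3 * S.b ^ 2) * T with hc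
  obtain ⟨D, hD⟩ := exists_lintegral_le_of_le_const_add_mul_lintegral c K T
  have hm : Measurable fun p : ℝ≥0 × Ω => ENNReal.ofReal (S.x p.1 p.2 ^ 2) :=
    (S.measurable_uncurry_x.pow_const 2).ennreal_ofReal
  have hms : Measurable fun p : Ω × ℝ≥0 => ENNReal.ofReal (S.x p.2 p.1 ^ 2) :=
    hm.comp measurable_swap
  set Y : Ω → ℝ≥0∞ := fun ω => ∫⁻ s in Iio T, ENNReal.ofReal (S.x s ω ^ 2) ∂leb with hY
  have hYm : Measurable Y := hms.lintegral_prod_right'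
  have hYt : ∀ ω, Y ω < ∞ := fun ω => by
    simp only [hY, S.setLIntegral_sq_x]; exact ENNReal.ofReal_lt_top
  have hswap : ∀ (A : Set Ω) (t : ℝ≥0),
      ∫⁻ s in Iio t, ∫⁻ ω in A, ENNReal.ofReal (S.x s ω ^ 2) ∂P ∂leb =
        ∫⁻ ω in A, ∫⁻ s in Iio t, ENNReal.ofReal (S.x s ω ^ 2) ∂leb ∂P := fun A t =>
    lintegral_lintegral_swap hm.aemeasurable
  -- The inequality is pathwise, so it may be integrated over any event, even the non-adapted `{Y ≤
  -- n}`, where the moment is trivially finite.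
  have hbound : ∀ n : ℕ, ∫⁻ ω in {ω | Y ω ≤ n}, Y ω ∂P ≤ D := by
    intro n
    have h := hD (fun s => ∫⁻ ω in {ω | Y ω ≤ n}, ENNReal.ofReal (S.x s ω ^ 2) ∂P) ?_ ?_
    · rwa [hswap] at h
    · intro t ht
      rw [hswap]
      have h1 : ∀ᵐ ω ∂(P.restrict {ω | Y ω ≤ n}), ENNReal.ofReal (S.x t ω ^ 2) ≤
          C + ENNReal.ofReal (3 * S.b ^ 2 * S.B t ω ^ 2)
            + K * ∫⁻ s in Iio t, ENNReal.ofReal (S.x s ω ^ 2) ∂leb :=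
        ae_restrict_of_ae (hCK.mono fun ω h => h t ht)
      have hm' : Measurable fun ω => ∫⁻ s in Iio t, ENNReal.ofReal (S.x s ω ^ 2) ∂leb :=
        hms.lintegral_prod_right'
      refine (lintegral_mono_ae h1).trans ?_
      rw [lintegral_add_right _ (hm'.const_mul _), lintegral_const_mul _ hm',
        lintegral_add_left measurable_const]
      refine add_le_add ?_ le_rfl
      rw [hc]
      push_cast
      refine add_le_add ?_ ?_
      · rw [lintegral_const]
        rw [Measure.restrict_apply_univ]
        exact mul_le_of_le_one_right' prob_le_one
      · refine (setLIntegral_le_lintegral _ _).trans ?_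
        have e : ∀ ω, ENNReal.ofReal (3 * S.b ^ 2 * S.B t ω ^ 2)
            = ENNReal.ofReal (3 * S.b ^ 2) * ENNReal.ofReal (S.B t ω ^ 2) := fun ω =>
          ENNReal.ofReal_mul (by positivity)
        simp_rw [e]
        rw [lintegral_const_mul' _ _ ENNReal.ofReal_ne_top, S.lintegral_sq_brownian t]
        exact mul_le_mul' le_rfl (by exact_mod_cast ht.le)
    · rw [hswap]
      refine ((setLIntegral_mono (s := {ω | Y ω ≤ n}) measurable_const
        fun ω hω => hω).trans_lt ?_).ne
      rw [setLIntegral_const]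
      exact ENNReal.mul_lt_top (by simp) (measure_lt_top _ _)
  have hU : (⋃ n : ℕ, {ω | Y ω ≤ n}) = univ := by
    ext ω
    simp only [mem_iUnion, mem_ofPred_eq, mem_univ, iff_true]
    obtain ⟨n, hn⟩ := ENNReal.exists_nat_gt (hYt ω).ne
    exact ⟨n, hn.le⟩
  have hdir : Directed (· ⊆ ·) fun n : ℕ => {ω | Y ω ≤ n} :=
    (monotone_nat_of_le_succ fun n ω (hω : Y ω ≤ n) =>
      hω.trans (by exact_mod_cast n.le_succ)).directed_le
  have hsup := setLIntegral_iUnion_of_directed (μ := P) Y hdir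
  rw [hU, setLIntegral_univ] at hsup
  rw [hsup]
  exact ((iSup_le hbound).trans_lt ENNReal.coe_lt_top).ne

end LinearDiffusion

/-! ### Mean square error decomposition -/

lemma lintegral_sq_sub_const {Ω : Type*} [MeasurableSpace Ω] {ν : Measure Ω}
    [IsProbabilityMeasure ν] {X : Ω → ℝ} (hX : MemLp X 2 ν) (c : ℝ) :
    ∫⁻ ω, ENNReal.ofReal ((X ω - c) ^ 2) ∂ν =
      ∫⁻ ω, ENNReal.ofReal ((X ω - ∫ ω', X ω' ∂ν) ^ 2) ∂ν
        + ENNReal.ofReal ((∫ ω', X ω' ∂ν - c) ^ 2) := by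
  set m := ∫ ω', X ω' ∂ν with hm
  have hi : Integrable X ν := hX.integrable one_le_two
  have hsq : ∀ d : ℝ, Integrable (fun ω => (X ω - d) ^ 2) ν := fun d =>
    (hX.sub (memLp_const d)).integrable_sq
  have e : ∀ d : ℝ, ∫⁻ ω, ENNReal.ofReal ((X ω - d) ^ 2) ∂ν
      = ENNReal.ofReal (∫ ω, (X ω - d) ^ 2 ∂ν) := fun d =>
    (ofReal_integral_eq_lintegral_ofReal (hsq d)
      (Eventually.of_forall fun ω => sq_nonneg _)).symm
  rw [e, e, ← ENNReal.ofReal_add (integral_nonneg fun ω => sq_nonneg _) (sq_nonneg _)]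
  congr 1
  have h1 : ∀ ω, (X ω - c) ^ 2
      = (X ω - m) ^ 2 + (2 * (m - c) * (X ω - m) + (m - c) ^ 2) := fun ω => by ring
  have hi2 : Integrable (fun ω => 2 * (m - c) * (X ω - m)) ν :=
    (hi.sub (integrable_const m)).const_mul _
  simp_rw [h1]
  have hi3 : Integrable (fun ω => 2 * (m - c) * (X ω - m) + (m - c) ^ 2) ν :=
    hi2.add (integrable_const _)
  rw [integral_add (hsq m) hi3, integral_add hi2 (integrable_const _),
    integral_const_mul, integral_sub hi (integrable_const m), ← hm]
  simp

/-- Bias-variance decomposition under `cond P A`, rescaled by `P A`; for a null event every term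
vanishes, so no positivity is required. -/
lemma setLIntegral_sq_sub_const {Ω : Type*} [MeasurableSpace Ω] {P : Measure Ω}
    [IsProbabilityMeasure P] {X : Ω → ℝ} (hX : MemLp X 2 P) (A : Set Ω) (c : ℝ) :
    ∫⁻ ω in A, ENNReal.ofReal ((X ω - c) ^ 2) ∂P =
      ∫⁻ ω in A, ENNReal.ofReal ((X ω - ∫ ω', X ω' ∂(cond P A)) ^ 2) ∂P
        + P A * ENNReal.ofReal ((∫ ω', X ω' ∂(cond P A) - c) ^ 2) := by
  by_cases hA : P A = 0
  · simp [Measure.restrict_eq_zero.2 hA, hA]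
  have : IsProbabilityMeasure (cond P A) := cond_isProbabilityMeasure hA
  have hr : P.restrict A = P A • cond P A := by
    rw [ProbabilityTheory.cond, smul_smul, ENNReal.mul_inv_cancel hA (measure_ne_top P A), one_smul]
  have hXc : MemLp X 2 (cond P A) :=
    (hX.restrict A).smul_measure (ENNReal.inv_ne_top.2 hA)
  rw [hr, lintegral_smul_measure, lintegral_smul_measure, lintegral_sq_sub_const hXc c, smul_eq_mul,
    smul_eq_mul, mul_add]

/-- On an atom of `m` of positive probability, the conditional expectation given `m` is the
elementary conditional expectation. -/
lemma condExp_eq_integral_cond_of_atom {Ω : Type*} {m mΩ : MeasurableSpace Ω} {P : Measure Ω}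
    [IsProbabilityMeasure P] (hm : m ≤ mΩ) {X : Ω → ℝ} (hX : Integrable X P) {A : Set Ω}
    (hAm : MeasurableSet[m] A) (hA : P A ≠ 0)
    (hatom : ∀ V, MeasurableSet[m] V → ∀ ω ∈ A, ∀ ω' ∈ A, ω ∈ V → ω' ∈ V) {ω₀ : Ω} (hω₀ : ω₀ ∈ A) :
    (P[X | m]) ω₀ = ∫ ω, X ω ∂(cond P A) := by
  set g := P[X | m]
  -- The level set of `g` through `ω₀` is `m`-measurable, so it cannot split the atom.
  have hconst : ∀ ω ∈ A, g ω = g ω₀ := fun ω hω =>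
    hatom _ (stronglyMeasurable_condExp.measurable (measurableSet_singleton (g ω₀))) ω₀ hω₀ ω hω rfl
  have hset : ∫ ω in A, g ω ∂P = ∫ ω in A, X ω ∂P := setIntegral_condExp hm hX hAm
  rw [setIntegral_congr_fun (hm _ hAm) hconst, setIntegral_const, smul_eq_mul] at hset
  have hne : P.real A ≠ 0 := (measureReal_ne_zero_iff (measure_ne_top P A)).2 hA
  rw [ProbabilityTheory.cond, integral_smul_measure, smul_eq_mul, ← hset, ENNReal.toReal_inv]
  exact (inv_mul_cancel_left₀ hne _).symm

/-! ### Sampling times and finiteness of the optimal value -/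

namespace LinearDiffusion

variable {Ω : Type*} [MeasurableSpace Ω] {P : Measure Ω}

lemma IsSamplingTime.measurable {S : LinearDiffusion P} {T : ℝ≥0} {τ : Ω → ℝ≥0}
    (hτ : S.IsSamplingTime T τ) : Measurable τ := by
  refine measurable_of_Iic fun t => S.filtration.le t _ ?_
  have h := hτ.1 t
  simp only [WithTop.coe_le_coe] at h
  exact h

lemma isSamplingTime_const (S : LinearDiffusion P) {h t : ℝ≥0} (ht : t ≤ h) :
    S.IsSamplingTime h fun _ => t :=
  ⟨isStoppingTime_const S.filtration t, fun _ => ht⟩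

lemma Jstar_zero (S : LinearDiffusion P) (m : ℕ) : S.Jstar 0 m = 0 := by
  refine le_antisymm ?_ zero_le
  refine (iInf₂_le (fun (_ : Fin m) (_ : Ω) => (0 : ℝ≥0))
    ⟨fun _ => S.isSamplingTime_const le_rfl, fun _ _ _ _ => le_rfl⟩).trans ?_
  simp [distortion]

/-- Waiting until `T` leaves no continuation cost, only the aggregate second moment. -/
lemma G_zero_ne_top [IsProbabilityMeasure P] (S : LinearDiffusion P) (T : ℝ≥0) (N : ℕ) :
    S.G T N (fun _ => 0) ≠ ∞ := by
  have h : S.G T N (fun _ => 0) ≤ S.H T N (fun _ => T) (fun _ => 0) :=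
    iInf₂_le _ (S.isSamplingTime_const le_rfl)
  refine (h.trans_lt ?_).ne
  simp only [H, tsub_self, Jstar_zero, add_zero, sub_zero]
  exact (S.lintegral_sq_ne_top T).lt_top

/-- Almost every marginal of the state is square integrable. -/
lemma ae_memLp_two [IsProbabilityMeasure P] (S : LinearDiffusion P) (T : ℝ≥0) :
    ∀ᵐ t ∂leb.restrict (Iio T), MemLp (S.x t) 2 P := by
  have hm : Measurable fun p : ℝ≥0 × Ω => ENNReal.ofReal (S.x p.1 p.2 ^ 2) :=
    (S.measurable_uncurry_x.pow_const 2).ennreal_ofReal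
  have h := S.lintegral_sq_ne_top T
  rw [← lintegral_lintegral_swap hm.aemeasurable] at h
  filter_upwards [ae_lt_top hm.lintegral_prod_right' h] with t ht
  refine (memLp_two_iff_integrable_sq (S.measurable_x t).aestronglyMeasurable).2
    ⟨((S.measurable_x t).pow_const 2).aestronglyMeasurable, ?_⟩
  rw [hasFiniteIntegral_iff_ofReal (Eventually.of_forall fun ω => sq_nonneg _)]
  exact ht

/-! ### The running cost as an integral over survival events -/

lemma lintegral_running_cost [SFinite P] (S : LinearDiffusion P) {τ : Ω → ℝ≥0}
    (hτ : Measurable τ) {η : ℝ≥0 → ℝ} (hη : Measurable η) :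
    ∫⁻ ω, ∫⁻ s in Iio (τ ω), ENNReal.ofReal ((S.x s ω - η s) ^ 2) ∂leb ∂P =
      ∫⁻ s, ∫⁻ ω in {ω | s < τ ω}, ENNReal.ofReal ((S.x s ω - η s) ^ 2) ∂P ∂leb := by
  have hm : Measurable fun p : ℝ≥0 × Ω => ENNReal.ofReal ((S.x p.1 p.2 - η p.1) ^ 2) :=
    ((S.measurable_uncurry_x.sub (hη.comp measurable_fst)).pow_const 2).ennreal_ofReal
  have hD : MeasurableSet {p : ℝ≥0 × Ω | p.1 < τ p.2} :=
    measurableSet_lt measurable_fst (hτ.comp measurable_snd)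
  have h := lintegral_lintegral_swap (μ := leb) (ν := P)
    (f := fun s ω => {p : ℝ≥0 × Ω | p.1 < τ p.2}.indicator
      (fun p => ENNReal.ofReal ((S.x p.1 p.2 - η p.1) ^ 2)) (s, ω))
    (hm.indicator hD).aemeasurable
  rw [eq_comm] at h
  convert h using 3 with ω s
  · rw [← lintegral_indicator measurableSet_Iio]
    rfl
  · rw [← lintegral_indicator (measurableSet_lt measurable_const hτ)]
    rfl

lemma measurable_running_cost [SFinite P] (S : LinearDiffusion P) {τ : Ω → ℝ≥0}
    (hτ : Measurable τ) {η : ℝ≥0 → ℝ} (hη : Measurable η) :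
    Measurable fun ω => ∫⁻ s in Iio (τ ω), ENNReal.ofReal ((S.x s ω - η s) ^ 2) ∂leb := by
  have hm : Measurable fun p : Ω × ℝ≥0 => ENNReal.ofReal ((S.x p.2 p.1 - η p.2) ^ 2) :=
    (((S.measurable_uncurry_x.comp measurable_swap).sub
      (hη.comp measurable_snd)).pow_const 2).ennreal_ofReal
  have hD : MeasurableSet {p : Ω × ℝ≥0 | p.2 < τ p.1} :=
    measurableSet_lt measurable_snd (hτ.comp measurable_fst)
  have h := (hm.indicator hD).lintegral_prod_right' (ν := leb)
  convert h using 2 with ω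
  rw [← lintegral_indicator measurableSet_Iio]
  rfl

/-- The conditional mean of the state given that sampling has not yet occurred. -/
noncomputable def survivalMean (S : LinearDiffusion P) (τ : Ω → ℝ≥0) (t : ℝ≥0) : ℝ :=
  ∫ ω, S.x t ω ∂(cond P {ω | t < τ ω})

lemma measurableSet_survival {τ : Ω → ℝ≥0} (hτ : Measurable τ) :
    MeasurableSet {p : ℝ≥0 × Ω | p.1 < τ p.2} :=
  measurableSet_lt measurable_fst (hτ.comp measurable_snd)

lemma measurable_measure_survival [SFinite P] {τ : Ω → ℝ≥0} (hτ : Measurable τ) :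
    Measurable fun t => P {ω | t < τ ω} :=
  measurable_measure_prodMk_left (measurableSet_survival hτ)

/-- Makes the survival mean an admissible competitor among Borel waveforms. -/
lemma measurable_survivalMean [SFinite P] (S : LinearDiffusion P) {τ : Ω → ℝ≥0}
    (hτ : Measurable τ) : Measurable (S.survivalMean τ) := by
  have h1 : Measurable fun t => ((P {ω | t < τ ω})⁻¹).toReal :=
    (measurable_measure_survival hτ).inv.ennreal_toReal
  have h2 : StronglyMeasurable fun t => ∫ ω, {p : ℝ≥0 × Ω | p.1 < τ p.2}.indicator
      (Function.uncurry S.x) (t, ω) ∂P :=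
    (S.measurable_uncurry_x.indicator
      (measurableSet_survival hτ)).stronglyMeasurable.integral_prod_right'
  have e : S.survivalMean τ = fun t => ((P {ω | t < τ ω})⁻¹).toReal *
      ∫ ω, {p : ℝ≥0 × Ω | p.1 < τ p.2}.indicator (Function.uncurry S.x) (t, ω) ∂P := by
    funext t
    rw [survivalMean, ProbabilityTheory.cond, integral_smul_measure, smul_eq_mul,
      ← integral_indicator (measurableSet_lt measurable_const hτ)]
    rfl
  rw [e]
  exact h1.mul h2.measurable

/-! ### The estimate before the first sample -/

lemma measurable_packet (S : LinearDiffusion P) {τ : Ω → ℝ≥0} (hτ : Measurable τ) (t : ℝ≥0) :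
    Measurable (S.packet τ t) := by
  refine Measurable.ite (measurableSet_le hτ measurable_const) ?_ measurable_const
  exact measurable_const.prodMk (hτ.coe_nnreal_real.prodMk
    (S.measurable_uncurry_x.comp (hτ.prodMk measurable_id)))

/-- Before the sample arrives, the MMSE estimate is the conditional mean given survival. -/
lemma mmse_eq_survivalMean [IsProbabilityMeasure P] (S : LinearDiffusion P) {τ : Ω → ℝ≥0}
    (hτ : Measurable τ) {t : ℝ≥0} (hint : Integrable (S.x t) P) (hA : P {ω | t < τ ω} ≠ 0)
    {ω₀ : Ω} (hω₀ : t < τ ω₀) :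
    S.mmse (fun _ : Fin 1 => τ) t ω₀ = S.survivalMean τ t := by
  have hdata : S.dataSigma (fun _ : Fin 1 => τ) t
      = MeasurableSpace.comap (S.packet τ t) inferInstance := iSup_const
  have hpk : ∀ ω, t < τ ω → S.packet τ t ω = (0, 0, 0) := fun ω hω => if_neg (not_le.2 hω)
  rw [mmse, hdata]
  refine condExp_eq_integral_cond_of_atom (S.measurable_packet hτ t).comap_le hint
    -- The arrival flag makes survival observable, even if a genuine sample has `τ = 0` and `x_τ =
    -- 0`.
    ⟨{p | p.1 = 0}, measurableSet_eq_fun measurable_fst measurable_const, ?_⟩ hA ?_ hω₀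
  · ext ω
    by_cases h : τ ω ≤ t
    · simp [packet, h]
    · simp [packet, h, not_le.1 h]
  · rintro _ ⟨V, -, rfl⟩ ω hω ω' hω' hV
    rw [mem_preimage, hpk ω hω] at hV
    rwa [mem_preimage, hpk ω' hω']

/-! ### Optimal waveforms -/

/-- If `ξ` is at least as good as the survival mean for the stopping rule `τ`, then the two agree
as long as survival has positive probability. -/
lemma ae_eq_survivalMean_of_H_le [IsProbabilityMeasure P] (S : LinearDiffusion P) {T : ℝ≥0} {N : ℕ}
    {τ : Ω → ℝ≥0} (hτ : S.IsSamplingTime T τ) {ξ : ℝ≥0 → ℝ} (hξ : Measurable ξ)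
    (hfin : S.H T N τ ξ ≠ ∞) (hle : S.H T N τ ξ ≤ S.H T N τ (S.survivalMean τ)) :
    ∀ᵐ t ∂leb, P {ω | t < τ ω} ≠ 0 → ξ t = S.survivalMean τ t := by
  have hτm := hτ.measurable
  have hmm := S.measurable_survivalMean hτm
  have hH : ∀ {η : ℝ≥0 → ℝ}, Measurable η → S.H T N τ η =
      ∫⁻ s, ∫⁻ ω in {ω | s < τ ω}, ENNReal.ofReal ((S.x s ω - η s) ^ 2) ∂P ∂leb
        + ∫⁻ ω, S.Jstar (T - τ ω) (N - 1) ∂P := fun hη => by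
    rw [H, lintegral_add_left (S.measurable_running_cost hτm hη), S.lintegral_running_cost hτm hη]
  set d : ℝ≥0 → ℝ≥0∞ := fun s =>
    P {ω | s < τ ω} * ENNReal.ofReal ((S.survivalMean τ s - ξ s) ^ 2) with hd
  have hdm : Measurable d :=
    (measurable_measure_survival hτm).mul ((hmm.sub hξ).pow_const 2).ennreal_ofReal
  have hdec : ∫⁻ s, ∫⁻ ω in {ω | s < τ ω}, ENNReal.ofReal ((S.x s ω - ξ s) ^ 2) ∂P ∂leb =
      ∫⁻ s, ∫⁻ ω in {ω | s < τ ω},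
        ENNReal.ofReal ((S.x s ω - S.survivalMean τ s) ^ 2) ∂P ∂leb + ∫⁻ s, d s ∂leb := by
    rw [← lintegral_add_right _ hdm]
    refine lintegral_congr_ae ?_
    filter_upwards [(ae_restrict_iff' measurableSet_Iio).1 (S.ae_memLp_two T)] with s hs
    rcases lt_or_ge s T with h | h
    · exact setLIntegral_sq_sub_const (hs h) _ _
    · have e : {ω | s < τ ω} = ∅ := by
        ext ω
        simpa using (hτ.2 ω).trans h
      simp [hd, e]
  rw [hH hξ] at hfin hle
  rw [hH hmm] at hle
  -- The continuation cost depends on `τ` alone, so it cancels once known to be finite.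
  have hle' := (ENNReal.add_le_add_iff_right (ENNReal.add_ne_top.1 hfin).2).1 hle
  have hfin' := (ENNReal.add_ne_top.1 hfin).1
  rw [hdec] at hle' hfin'
  have hd0 : ∫⁻ s, d s ∂leb = 0 := by
    have h2 := hle'.trans_eq (add_zero _).symm
    exact le_antisymm ((ENNReal.add_le_add_iff_left (ENNReal.add_ne_top.1 hfin').1).1 h2) zero_le
  filter_upwards [(lintegral_eq_zero_iff hdm).1 hd0] with s hs hA
  have h := (mul_eq_zero.1 hs).resolve_left hA
  have h2 := le_antisymm (ENNReal.ofReal_eq_zero.1 h) (sq_nonneg _)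
  exact (sub_eq_zero.1 (pow_eq_zero_iff two_ne_zero |>.1 h2)).symm

end LinearDiffusion

end AdaptiveSampling
theorem mainTheorem7 {Ω : Type*} [MeasurableSpace Ω] (P : Measure Ω) [IsProbabilityMeasure P]
    (S : AdaptiveSampling.LinearDiffusion P) (T : ℝ≥0) (N : ℕ) (hN : 1 ≤ N)
    (ξ : ℝ≥0 → ℝ) (hξ : Measurable ξ)
    (hmin : ∀ η : ℝ≥0 → ℝ, Measurable η → S.G T N ξ ≤ S.G T N η)
    (τ : Ω → ℝ≥0) (hτ : S.IsOptimalStopping T N ξ τ) :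
    (∀ (σ : Ω → ℝ≥0) (η : ℝ≥0 → ℝ), S.IsSamplingTime T σ → Measurable η →
      S.H T N τ ξ ≤ S.H T N σ η) ∧
    (∀ᵐ t ∂(AdaptiveSampling.leb.restrict (Iic T)),
      Integrable (S.x t) P ∧
      (P {ω | t < τ ω} ≠ 0 → ξ t = ∫ ω, S.x t ω ∂(cond P {ω | t < τ ω})) ∧
      (∀ᵐ ω ∂P, t < τ ω → ξ t = S.mmse (fun _ : Fin 1 => τ) t ω)) := by
  have hH : ∀ (σ : Ω → ℝ≥0) (η : ℝ≥0 → ℝ), S.IsSamplingTime T σ → Measurable η →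
      S.H T N τ ξ ≤ S.H T N σ η := fun σ η hσ hη =>
    (hτ.2.trans_le (hmin η hη)).trans (iInf₂_le σ hσ)
  refine ⟨hH, ?_⟩
  have hτm := hτ.1.measurable
  have hfin : S.H T N τ ξ ≠ ∞ := by
    rw [hτ.2]
    exact ((hmin _ measurable_const).trans_lt (S.G_zero_ne_top T N).lt_top).ne
  have hmean := S.ae_eq_survivalMean_of_H_le hτ.1 hξ hfin
    (hH τ _ hτ.1 (S.measurable_survivalMean hτm))
  -- The longer horizon `T + 1` covers the closed interval without treating the endpoint separately.
  have hL : ∀ᵐ t ∂(AdaptiveSampling.leb.restrict (Iic T)), MemLp (S.x t) 2 P :=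
    ae_restrict_of_ae_restrict_of_subset
      (fun t (ht : t ≤ T) => lt_of_le_of_lt ht (lt_add_one T)) (S.ae_memLp_two (T + 1))
  filter_upwards [ae_restrict_of_ae hmean, hL] with t ht hLt
  have hint : Integrable (S.x t) P := hLt.integrable one_le_two
  refine ⟨hint, ht, ?_⟩
  by_cases hA : P {ω | t < τ ω} = 0
  · filter_upwards [measure_eq_zero_iff_ae_notMem.1 hA] with ω hω h
    exact absurd h hω
  · exact Eventually.of_forall fun ω hω =>
      (ht hA).trans (S.mmse_eq_survivalMean hτm hint hA hω).symm
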